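/- For $n \ge 1$ let $\mathcal{M}_{2n}$ be the Maiorana--McFarland class, i.e. the set of all Boolean functions $f_{\pi,\varphi} : \mathbb{F}_2^n \times \mathbb{F}_2^n \to \mathbb{F}_2$ of the form $f_{\pi,\varphi}(x,y) = \langle x, \pi(y)\rangle \oplus \varphi(y)$, where $\pi$ is a permutation of $\mathbb{F}_2^n$, $\varphi : \mathbb{F}_2^n \to \mathbb{F}_2$ is arbitrary and $\langle x, z\rangle = x_1z_1 \oplus \dots \oplus x_nz_n$. For $f : \mathbb{F}_2^{2n} \to \mathbb{F}_2$ let $$\mathcal{N}(f) = \{ f \oplus \mathbb{1}_U : U \text{ is an } n\text{-dimensional affine subspace of } \mathbb{F}_2^{2n} \text{ and } f|_U \text{ is affine} \},$$ where $\mathbb{1}_U$ is the characteristic function of $U$, and $f|_U$ is affine if it is the restriction to $U$ of an affine function $\mathbb{F}_2^{2n} \to \mathbb{F}_2$. Then, as $n \to \infty$, $$\frac{1}{|\mathcal{M}_{2n}|}\sum_{f \in \mathcal{M}_{2n}} |\mathcal{N}(f)| = \frac{10}{3}\, 2^{2n} - 2^n + \frac{176}{21} + o(1).$$ With $\ell_{2n}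 = 2^{2n+1} - 2^n$, the same average can also be written as $\ell_{2n} + \frac{4}{3}\, 2^{2n} + \frac{176}{21} + o(1)$ and as $\frac{5}{3}\, \ell_{2n} + \frac{2}{3}\, 2^n + \frac{176}{21} + o(1)$. -/

import Mathlib

open Filter Asymptotics

noncomputable section

/-- The vector space `𝔽₂ⁿ`. -/
abbrev F2 (n : ℕ) : Type := Fin n → ZMod 2

/-- The space `𝔽₂²ⁿ`, written as pairs `(x, y)` with `x, y ∈ 𝔽₂ⁿ`. -/
abbrev F2Pair (n : ℕ) : Type := F2 n × F2 n

/-- The function `f_{π,φ}(x, y) = ⟨x, π(y)⟩ ⊕ φ(y)`. -/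
def mmFunction {n : ℕ} (π : Equiv.Perm (F2 n)) (φ : F2 n → ZMod 2) : F2Pair n → ZMod 2 :=
  fun p => dotProduct p.1 (π p.2) + φ p.2

/-- The Maiorana--McFarland class of Boolean functions in `2n` variables. -/
def maioranaMcFarland (n : ℕ) : Set (F2Pair n → ZMod 2) :=
  {f | ∃ (π : Equiv.Perm (F2 n)) (φ : F2 n → ZMod 2), f = mmFunction π φ}

/-- The set of all `k`-dimensional (nonempty) affine subspaces of a vector space over `𝔽₂`. -/
def affineSubspacesOfDim (V : Type) [AddCommGroup V] [Module (ZMod 2) V] (k : ℕ) :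
    Set (AffineSubspace (ZMod 2) V) :=
  {U | (U : Set V).Nonempty ∧ Module.finrank (ZMod 2) U.direction = k}

/-- `f` is affine on `U`: the restriction of `f` to `U` coincides with the restriction of an
affine function defined on the whole space. -/
def IsAffineOn {V : Type} [AddCommGroup V] [Module (ZMod 2) V] (f : V → ZMod 2)
    (U : AffineSubspace (ZMod 2) V) : Prop :=
  ∃ g : V →ᵃ[ZMod 2] ZMod 2, ∀ x ∈ U, f x = g x

/-- `𝒩(f)`: all functions `f ⊕ 𝟙_U`, where `U` is an `n`-dimensional affine subspace of `𝔽₂²ⁿ`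
on which `f` is affine. -/
def nearSet {n : ℕ} (f : F2Pair n → ZMod 2) : Set (F2Pair n → ZMod 2) :=
  {g | ∃ U ∈ affineSubspacesOfDim (F2Pair n) n, IsAffineOn f U ∧
    g = f + Set.indicator (U : Set (F2Pair n)) 1}

/-- The average of `|𝒩(f)|` over all `f` in the Maiorana--McFarland class in `2n` variables. -/
def nearAverage (n : ℕ) : ℝ :=
  (∑ f ∈ (Set.toFinite (maioranaMcFarland n)).toFinset, ((nearSet f).ncard : ℝ)) /
    ((maioranaMcFarland n).ncard : ℝ)

end

/-! Double counting. Since `f + 𝟙_U` determines `U`, `|𝒩(f)|` counts the admissible `U`, so the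
average is the sum over `U` of the probability that a random pair `(π, φ)` gives a function affine
on `U`.

Let `W` be the projection of the direction of `U` to the `y`-factor, `L` its vertical part, `k = dim
W`, so `dim L = n - k`. Affinity on `U` means that `π` maps a coset of `W` onto a coset of `L^⊥`,
and that `φ` on the former coset is affine up to a correction depending on `π`
(`isAffineOn_mmFunction_iff`). The probabilities are `2^(n-k) / C(2^n, 2^k)` and `2^(k+1) /
2^(2^k)`; their product depends only on `n` and `k` (`card_mmFunction_isAffineOn`). The number of
`U` of type `k` is `[n k]₂² 2^(k²) 2^n` (`card_affineSubspace_finrank_map_snd`).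

With `N = 2^n`, the terms of the resulting sum over `k` are `N` for `k = 0`, `2N² - 2N` for `k = 1`,
`(4/3)N² + 8/3 + o(1)` for `k = 2` and `40/7 + o(1)` for `k = 3`. Each term with `k ≥ 4` is `O(1/N)`
uniformly in `k`, so all of them together vanish in the limit. -/

/-! ### Counting by fibres -/

theorem Nat.card_eq_sum_card_fiber {A B : Type*} [Finite A] [Fintype B] (f : A → B) :
    Nat.card A = ∑ b, Nat.card {a // f a = b} := by
  rw [← Nat.card_congr (Equiv.sigmaFiberEquiv f), Nat.card_sigma]

theorem Nat.card_eq_mul_of_card_fiber {A B : Type*} [Finite A] [Finite B] (f : A → B) {c : ℕ}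
    (h : ∀ b, Nat.card {a // f a = b} = c) : Nat.card A = Nat.card B * c := by
  have := Fintype.ofFinite B
  rw [Nat.card_eq_sum_card_fiber f, Finset.sum_congr rfl fun b _ => h b]
  simp

/-- If all fibres of `f` have the same size, the preimage of `T` has the density of `T`. -/
theorem Nat.card_preimage_mul_card {A B : Type*} [Finite A] [Finite B] (f : A → B)
    (h : ∀ b b', Nat.card {a // f a = b} = Nat.card {a // f a = b'}) (T : Set B) :
    Nat.card {a // f a ∈ T} * Nat.card B = Nat.card T * Nat.card A := by
  rcases isEmpty_or_nonempty B with hB | ⟨⟨b₀⟩⟩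
  · have : IsEmpty T := ⟨fun t => hB.false t.1⟩
    simp
  rw [Nat.card_eq_mul_of_card_fiber f fun b => h b b₀,
    Nat.card_eq_mul_of_card_fiber (fun a : {a // f a ∈ T} => (⟨f a.1, a.2⟩ : T))
      (c := Nat.card {a // f a = b₀})]
  · ring
  · rintro ⟨t, ht⟩
    rw [← h t b₀]
    exact Nat.card_congr
      { toFun := fun a => ⟨a.1.1, congrArg Subtype.val a.2⟩
        invFun := fun a => ⟨⟨a.1, by rw [a.2]; exact ht⟩, Subtype.ext a.2⟩
        left_inv := fun _ => rfl
        right_inv := fun _ => rfl }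

/-- By transitivity, left multiplication carries any fibre of `g ↦ g • x` onto any other, so a
random group element moves `x` to a uniformly distributed point. -/
theorem MulAction.card_smul_mem_mul_card {G X : Type*} [Group G] [MulAction G X] [Finite G]
    [Finite X] [MulAction.IsPretransitive G X] (x : X) (T : Set X) :
    Nat.card {g : G // g • x ∈ T} * Nat.card X = Nat.card T * Nat.card G := by
  refine Nat.card_preimage_mul_card (fun g : G => g • x) (fun b b' => ?_) T
  obtain ⟨g, hg⟩ := MulAction.exists_smul_eq G b b'
  refine Nat.card_congr ((Equiv.mulLeft g).subtypeEquiv fun a => ?_)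
  simp only [Equiv.coe_mulLeft, mul_smul, ← hg]
  exact (smul_left_cancel_iff g).symm

theorem AddMonoidHom.card_preimage_mul_card {G H : Type*} [AddGroup G] [AddGroup H] [Finite G]
    [Finite H] (f : G →+ H) (hf : Function.Surjective f) (T : Set H) :
    Nat.card {g // f g ∈ T} * Nat.card H = Nat.card T * Nat.card G := by
  refine Nat.card_preimage_mul_card f (fun b b' => ?_) T
  obtain ⟨g, hg⟩ := hf (b' - b)
  refine Nat.card_congr ((Equiv.addLeft g).subtypeEquiv fun a => ?_)
  simp only [Equiv.coe_addLeft, map_add, hg]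
  constructor
  · rintro rfl; simp
  · intro h
    have := congrArg (fun z => -(b' - b) + z) h
    simpa [sub_eq_add_neg, add_assoc] using this

/-! ### Gaussian binomial coefficients -/

section Subspaces

variable {K V : Type*} [Field K] [AddCommGroup V] [Module K V]

instance Submodule.finite_of_finite [Finite V] : Finite (Submodule K V) :=
  Finite.of_injective _ SetLike.coe_injective

open Module

variable [Fintype K] [Finite V]

/-- The number of `k`-dimensional subspaces, as a Gaussian binomial coefficient. -/
theorem card_submodule_finrank_mul {k : ℕ} (hk : k ≤ finrank K V) :
    Nat.card {W : Submodule K V // finrank K W = k} *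
      ∏ i : Fin k, (Fintype.card K ^ k - Fintype.card K ^ i.val) =
      ∏ i : Fin k, (Fintype.card K ^ finrank K V - Fintype.card K ^ i.val) := by
  rw [← card_linearIndependent hk]
  symm
  refine Nat.card_eq_mul_of_card_fiber
    (fun s : {s : Fin k → V // LinearIndependent K s} =>
      (⟨Submodule.span K (Set.range s.1), by simpa using finrank_span_eq_card s.2⟩ :
        {W : Submodule K V // finrank K W = k})) ?_
  rintro ⟨W, rfl⟩
  rw [← card_linearIndependent (K := K) (V := W) le_rfl]
  refine Nat.card_congr
    { toFun := fun s => ⟨fun i => ⟨s.1.1 i, ?_⟩, ?_⟩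
      invFun := fun t => ⟨⟨fun i => (t.1 i : V), ?_⟩, ?_⟩
      left_inv := fun s => rfl
      right_inv := fun t => rfl }
  · have h : Submodule.span K (Set.range s.1.1) = W := congrArg Subtype.val s.2
    exact h.le (Submodule.subset_span ⟨i, rfl⟩)
  · exact LinearIndependent.of_comp W.subtype s.1.2
  · exact t.2.map' W.subtype W.ker_subtype
  · have hli : LinearIndependent K fun i => (t.1 i : V) := t.2.map' W.subtype W.ker_subtype
    refine Subtype.ext (Submodule.eq_of_le_of_finrank_eq ?_ ?_)
    · rw [Submodule.span_le]
      rintro _ ⟨i, rfl⟩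
      exact (t.1 i).2
    · simpa using finrank_span_eq_card hli

end Subspaces

/-! ### Subspaces of a product -/

section Product

open Module

variable {K X Y : Type*} [Field K] [AddCommGroup X] [Module K X] [AddCommGroup Y] [Module K Y]

/-- Rank-nullity for the second projection restricted to `D`, whose kernel is the vertical part of
`D`. -/
theorem Submodule.finrank_map_snd_add_finrank_comap_inl [FiniteDimensional K X]
    [FiniteDimensional K Y] (D : Submodule K (X × Y)) :
    finrank K (D.map (LinearMap.snd K X Y)) + finrank K (D.comap (LinearMap.inl K X Y)) =
      finrank K D := by
  rw [← LinearMap.finrank_range_add_finrank_ker ((LinearMap.snd K X Y).domRestrict D),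
    LinearMap.range_domRestrict]
  congr 1
  refine LinearEquiv.finrank_eq
    (LinearEquiv.ofBijective (LinearMap.codRestrict _ (LinearMap.codRestrict D
      ((LinearMap.inl K X Y).domRestrict _) fun c => c.2) fun c => ?_) ⟨?_, ?_⟩)
  · rw [LinearMap.mem_ker]; rfl
  · intro c d h
    have := congrArg (fun z => (z.1.1 : X × Y).1) h
    exact Subtype.ext this
  · rintro ⟨⟨⟨x, y⟩, h⟩, h'⟩
    have hy : y = 0 := by simpa using h'
    subst hy
    exact ⟨⟨x, h⟩, rfl⟩

/-- The subspace of `X × Y` lying over `W` with vertical part `L` and slope `g`. -/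
def Submodule.graphOver (W : Submodule K Y) (L : Submodule K X) (g : W →ₗ[K] X ⧸ L) :
    Submodule K (X × Y) :=
  (LinearMap.ker (L.mkQ ∘ₗ LinearMap.fst K X W - g ∘ₗ LinearMap.snd K X W)).map
    (LinearMap.id.prodMap W.subtype)

theorem Submodule.mem_graphOver {W : Submodule K Y} {L : Submodule K X} {g : W →ₗ[K] X ⧸ L}
    {p : X × Y} : p ∈ W.graphOver L g ↔ ∃ h : p.2 ∈ W, L.mkQ p.1 = g ⟨p.2, h⟩ := by
  simp only [graphOver, mem_map, LinearMap.mem_ker, LinearMap.sub_apply, sub_eq_zero]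
  constructor
  · rintro ⟨⟨x, w⟩, h, rfl⟩
    exact ⟨w.2, h⟩
  · rintro ⟨h, h'⟩
    exact ⟨(p.1, ⟨p.2, h⟩), h', rfl⟩

/-- A linear section of the projection of a subspace of `X × Y` to the second factor. -/
theorem Submodule.exists_linear_section (D : Submodule K (X × Y)) :
    ∃ s : (D.map (LinearMap.snd K X Y)) →ₗ[K] X, ∀ w, (s w, (w : Y)) ∈ D := by
  obtain ⟨t, ht⟩ := LinearMap.exists_rightInverse_of_surjective
    ((LinearMap.snd K X Y).submoduleMap D)
    (LinearMap.range_eq_top.2 (LinearMap.submoduleMap_surjective _ _))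
  refine ⟨LinearMap.fst K X Y ∘ₗ D.subtype ∘ₗ t, fun w => ?_⟩
  have h : ((t w : X × Y)).2 = w := congrArg Subtype.val (LinearMap.congr_fun ht w)
  have := (t w).2
  rw [← Prod.mk.eta (p := (t w : X × Y)), h] at this
  exact this

/-- Over each `w ∈ W` the fibre of `D` is a coset of `L`, so `D` amounts to a linear map `W → X ⧸
L`. The slope of a given `D` is a linear section of its projection, reduced modulo `L`. -/
theorem Submodule.bijective_graphOver (W : Submodule K Y) (L : Submodule K X) :
    Function.Bijective (fun g : W →ₗ[K] X ⧸ L =>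
      (⟨W.graphOver L g, by
        constructor
        · ext y
          constructor
          · rintro ⟨p, hp, rfl⟩
            exact (mem_graphOver.1 hp).1
          · intro hy
            obtain ⟨x, hx⟩ := L.mkQ_surjective (g ⟨y, hy⟩)
            exact ⟨(x, y), mem_graphOver.2 ⟨hy, hx⟩, rfl⟩
        · ext x
          rw [mem_comap, mem_graphOver]
          have h0 : (⟨0, W.zero_mem⟩ : W) = 0 := rfl
          simp [h0]⟩ :
        {D : Submodule K (X × Y) //
          D.map (LinearMap.snd K X Y) = W ∧ D.comap (LinearMap.inl K X Y) = L})) := by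
  constructor
  · intro g g' h
    ext w
    obtain ⟨x, hx⟩ := L.mkQ_surjective (g w)
    have hD : W.graphOver L g = W.graphOver L g' := congrArg Subtype.val h
    have hm : (x, (w : Y)) ∈ W.graphOver L g := mem_graphOver.2 ⟨w.2, hx⟩
    rw [hD, mem_graphOver] at hm
    rw [← hx]
    exact hm.2
  · rintro ⟨D, rfl, rfl⟩
    obtain ⟨s, hs⟩ := D.exists_linear_section
    refine ⟨Submodule.mkQ _ ∘ₗ s, Subtype.ext ?_⟩
    ext ⟨x, y⟩
    rw [mem_graphOver]
    have key : ∀ h : y ∈ D.map (LinearMap.snd K X Y),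
        (Submodule.mkQ (D.comap (LinearMap.inl K X Y)) x =
          (Submodule.mkQ (D.comap (LinearMap.inl K X Y)) ∘ₗ s) ⟨y, h⟩ ↔ (x, y) ∈ D) := by
      intro h
      rw [LinearMap.comp_apply, mkQ_apply, mkQ_apply, Submodule.Quotient.eq, mem_comap,
        ← Submodule.add_mem_iff_left D (hs ⟨y, h⟩)]
      simp
    exact ⟨fun ⟨h, h'⟩ => (key h).1 h', fun h => ⟨⟨_, h, rfl⟩, (key _).2 h⟩⟩

theorem Submodule.card_map_snd_comap_inl [Finite K] [Finite X] [Finite Y] (W : Submodule K Y)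
    (L : Submodule K X) :
    Nat.card {D : Submodule K (X × Y) //
      D.map (LinearMap.snd K X Y) = W ∧ D.comap (LinearMap.inl K X Y) = L} =
      Nat.card K ^ (finrank K W * (finrank K X - finrank K L)) := by
  rw [← Nat.card_congr (Equiv.ofBijective _ (bijective_graphOver W L)),
    Module.natCard_eq_pow_finrank (K := K), Module.finrank_linearMap, Submodule.finrank_quotient]

end Product

/-! ### Cosets of a direction -/

section Affine

variable {K V : Type*} [Field K] [AddCommGroup V] [Module K V]

/-- Affine subspaces with direction `D` are the cosets of `D`. -/
theorem card_affineSubspace_direction (D : Submodule K V) :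
    Nat.card {U : AffineSubspace K V // (U : Set V).Nonempty ∧ U.direction = D} =
      Nat.card (V ⧸ D) := by
  refine (Nat.card_congr (Equiv.ofBijective (Quotient.lift
    (fun v => (⟨AffineSubspace.mk' v D, ⟨v, AffineSubspace.self_mem_mk' v D⟩,
      AffineSubspace.direction_mk' v D⟩ :
      {U : AffineSubspace K V // (U : Set V).Nonempty ∧ U.direction = D})) ?_) ⟨?_, ?_⟩)).symm
  · intro a b h
    refine Subtype.ext (AffineSubspace.ext_of_direction_eq (by simp)
      ⟨a, AffineSubspace.self_mem_mk' a D, ?_⟩)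
    have : a - b ∈ D := (Submodule.quotientRel_def D).1 h
    simpa [AffineSubspace.mem_mk'] using this
  · rintro ⟨a⟩ ⟨b⟩ h
    refine Quotient.sound ((Submodule.quotientRel_def D).2 ?_)
    have h' : AffineSubspace.mk' a D = AffineSubspace.mk' b D := congrArg Subtype.val h
    have : a ∈ AffineSubspace.mk' b D := h' ▸ AffineSubspace.self_mem_mk' a D
    simpa [AffineSubspace.mem_mk'] using this
  · rintro ⟨U, ⟨v, hv⟩, rfl⟩
    exact ⟨Quotient.mk _ v, Subtype.ext (AffineSubspace.mk'_eq hv)⟩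

end Affine

/-! ### Admissible pairs `(π, φ)` for a fixed affine subspace -/

section LocalCount

open Module

variable {n : ℕ}

/-- A Maiorana--McFarland function is affine on `U` iff `π` is constant modulo the annihilator of
the vertical part of `U` and the function is affine on a section of `U`. -/
theorem isAffineOn_mmFunction_iff (π : Equiv.Perm (F2 n)) (φ : F2 n → ZMod 2)
    (U : AffineSubspace (ZMod 2) (F2Pair n)) {p : F2Pair n} (hp : p ∈ U)
    (s : (U.direction.map (LinearMap.snd (ZMod 2) (F2 n) (F2 n))) →ₗ[ZMod 2] F2 n)
    (hs : ∀ w, (s w, (w : F2 n)) ∈ U.direction) :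
    IsAffineOn (mmFunction π φ) U ↔
      (∀ l ∈ U.direction.comap (LinearMap.inl (ZMod 2) (F2 n) (F2 n)),
        ∀ w ∈ U.direction.map (LinearMap.snd (ZMod 2) (F2 n) (F2 n)),
          dotProduct l (π (p.2 + w) - π p.2) = 0) ∧
      ∃ (μ : (U.direction.map (LinearMap.snd (ZMod 2) (F2 n) (F2 n))) →ₗ[ZMod 2] ZMod 2)
        (c : ZMod 2), ∀ w, dotProduct (p.1 + s w) (π (p.2 + w)) + φ (p.2 + w) = μ w + c := by
  have hadd : ∀ d ∈ U.direction, p + d ∈ U := fun d hd => by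
    rw [add_comm]; exact AffineSubspace.vadd_mem_of_mem_direction hd hp
  constructor
  · rintro ⟨g, hg⟩
    have hg' : ∀ d ∈ U.direction, mmFunction π φ (p + d) = g.linear d + g p := fun d hd => by
      rw [hg _ (hadd d hd), add_comm p d]
      exact g.map_vadd p d
    -- Compare the values at `p + (s w, w)` and at its vertical translate by `(l, 0)`: the
    -- difference is independent of `w`.
    have key : ∀ l ∈ U.direction.comap (LinearMap.inl (ZMod 2) (F2 n) (F2 n)),
        ∀ w : U.direction.map (LinearMap.snd (ZMod 2) (F2 n) (F2 n)),
        dotProduct l (π (p.2 + (w : F2 n))) = g.linear (l, 0) := by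
      intro l hl w
      have h1 := hg' _ (hs w)
      have h2 := hg' _ (U.direction.add_mem (hs w) hl)
      rw [map_add] at h2
      simp only [mmFunction, Prod.fst_add, Prod.snd_add, LinearMap.inl_apply, add_zero,
        add_dotProduct] at h1 h2
      linear_combination h2 - h1
    refine ⟨fun l hl w hw => ?_, g.linear ∘ₗ s.prod (Submodule.subtype _), g p, fun w => ?_⟩
    · have h1 := key l hl ⟨w, hw⟩
      have h2 := key l hl 0
      rw [dotProduct_sub, sub_eq_zero]
      simpa using h1.trans h2.symm
    · have h := hg' _ (hs w)
      simp only [mmFunction, Prod.fst_add, Prod.snd_add] at h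
      rw [h, LinearMap.comp_apply, LinearMap.prod_apply]
      rfl
  · rintro ⟨h1, μ, c, h2⟩
    let q : U.direction →ₗ[ZMod 2] (U.direction.map (LinearMap.snd (ZMod 2) (F2 n) (F2 n))) :=
      (LinearMap.snd (ZMod 2) (F2 n) (F2 n)).submoduleMap U.direction
    -- A direction `d` over `w` splits as `(s w, w)` plus a vertical vector. The form is `μ` on the
    -- first part and pairing with `π p.2` on the second, extended from the direction to the whole
    -- space.
    obtain ⟨G, hG⟩ := LinearMap.exists_extend
      (dotProductEquiv (ZMod 2) (Fin n) (π p.2) ∘ₗ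
        (LinearMap.fst (ZMod 2) (F2 n) (F2 n) ∘ₗ U.direction.subtype - s ∘ₗ q) + μ ∘ₗ q)
    refine ⟨G.toAffineMap - AffineMap.const _ _ (G p) + AffineMap.const _ _ c, fun x hx => ?_⟩
    have hd : x - p ∈ U.direction := AffineSubspace.vsub_mem_direction hx hp
    have hGx : G (x - p) = dotProduct (π p.2) ((x - p).1 - s (q ⟨x - p, hd⟩)) +
        μ (q ⟨x - p, hd⟩) := LinearMap.congr_fun hG ⟨x - p, hd⟩
    set w := q ⟨x - p, hd⟩ with hw
    have hwx : p.2 + (w : F2 n) = x.2 := by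
      change p.2 + (x - p).2 = x.2
      simp
    have hl : (x - p).1 - s w ∈ U.direction.comap (LinearMap.inl (ZMod 2) (F2 n) (F2 n)) := by
      have := U.direction.sub_mem hd (hs w)
      have h0 : (x - p) - (s w, (w : F2 n)) = ((x - p).1 - s w, 0) :=
        Prod.ext rfl (sub_self _)
      rw [h0] at this
      exact this
    have e1 := h1 _ hl w w.2
    have e2 := h2 w
    rw [hwx] at e1 e2
    rw [dotProduct_sub, dotProduct_comm _ (π p.2), sub_eq_zero] at e1
    have e3 : mmFunction π φ x =
        dotProduct (p.1 + s w) (π x.2) + φ x.2 + dotProduct ((x - p).1 - s w) (π x.2) := by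
      simp only [mmFunction, Prod.fst_sub, sub_dotProduct, add_dotProduct]
      ring
    rw [e3, e1, e2]
    simp only [AffineMap.coe_add, AffineMap.coe_sub, Pi.add_apply, Pi.sub_apply,
      LinearMap.coe_toAffineMap, AffineMap.coe_const, Function.const_apply]
    rw [← map_sub, hGx]
    ring

theorem finrank_F2 : finrank (ZMod 2) (F2 n) = n := by simp

theorem card_F2 : Nat.card (F2 n) = 2 ^ n := by simp

/-- The number of `φ` whose restriction to a coset of `W`, shifted by `h`, is affine. -/
theorem card_affine_restriction (W : Submodule (ZMod 2) (F2 n)) (b : F2 n) (h : W → ZMod 2) :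
    Nat.card {φ : F2 n → ZMod 2 // ∃ (μ : W →ₗ[ZMod 2] ZMod 2) (c : ZMod 2),
      ∀ w, h w + φ (b + w) = μ w + c} * 2 ^ 2 ^ finrank (ZMod 2) W =
      2 ^ (finrank (ZMod 2) W + 1) * Nat.card (F2 n → ZMod 2) := by
  let ρ : (F2 n → ZMod 2) →+ (W → ZMod 2) :=
    { toFun := fun φ w => φ (b + w)
      map_zero' := rfl
      map_add' := fun _ _ => rfl }
  have hρ : Function.Surjective ρ := by
    intro ψ
    have hinj : Function.Injective fun w : W => b + (w : F2 n) :=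
      fun w w' hw => Subtype.ext (add_left_cancel hw)
    exact ⟨Function.extend (fun w : W => b + (w : F2 n)) ψ 0,
      funext fun w => hinj.extend_apply _ _ w⟩
  -- Lists the admissible restrictions of `φ`: affine functions on `W` translated by `-h`.
  -- Injectivity gives `2 ^ (dim W + 1)` of them, whatever `h` is.
  let e : (W →ₗ[ZMod 2] ZMod 2) × ZMod 2 → (W → ZMod 2) := fun m w => m.1 w + m.2 - h w
  have he : Function.Injective e := by
    rintro ⟨μ, c⟩ ⟨μ', c'⟩ hm
    have h1 : ∀ w, μ w + c = μ' w + c' := fun w => by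
      have := congrFun hm w
      simpa [e] using this
    have hc : c = c' := by simpa using h1 0
    subst hc
    refine Prod.ext (LinearMap.ext fun w => ?_) rfl
    simpa using h1 w
  have hcard := ρ.card_preimage_mul_card hρ (Set.range e)
  rw [Nat.card_congr (Equiv.ofInjective e he).symm, Nat.card_prod,
    Module.natCard_eq_pow_finrank (K := ZMod 2) (V := W →ₗ[ZMod 2] ZMod 2),
    Module.finrank_linearMap] at hcard
  have hW : Nat.card (W → ZMod 2) = 2 ^ 2 ^ finrank (ZMod 2) W := by
    rw [Nat.card_fun, Module.natCard_eq_pow_finrank (K := ZMod 2) (V := W)]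
    simp
  rw [hW] at hcard
  have hset : Nat.card {φ : F2 n → ZMod 2 // ∃ (μ : W →ₗ[ZMod 2] ZMod 2) (c : ZMod 2),
      ∀ w, h w + φ (b + w) = μ w + c} = Nat.card {φ // ρ φ ∈ Set.range e} := by
    refine Nat.card_congr (Equiv.subtypeEquivRight fun φ => ?_)
    constructor
    · rintro ⟨μ, c, hm⟩
      refine ⟨(μ, c), funext fun w => ?_⟩
      change μ w + c - h w = φ (b + w)
      rw [← hm w]; ring
    · rintro ⟨⟨μ, c⟩, hm⟩
      refine ⟨μ, c, fun w => ?_⟩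
      have : μ w + c - h w = φ (b + w) := congrFun hm w
      rw [← this]; ring
  rw [hset, hcard]
  simp [pow_succ]

/-- The annihilator of a subspace of `𝔽₂ⁿ` for the dot product. -/
def dotAnnihilator (L : Submodule (ZMod 2) (F2 n)) : Submodule (ZMod 2) (F2 n) :=
  L.dualAnnihilator.comap (dotProductEquiv (ZMod 2) (Fin n)).toLinearMap

theorem mem_dotAnnihilator {L : Submodule (ZMod 2) (F2 n)} {v : F2 n} :
    v ∈ dotAnnihilator L ↔ ∀ l ∈ L, dotProduct l v = 0 := by
  rw [dotAnnihilator, Submodule.mem_comap, Submodule.mem_dualAnnihilator]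
  simp only [LinearEquiv.coe_coe, dotProductEquiv_apply_apply, dotProduct_comm]

theorem finrank_add_finrank_dotAnnihilator (L : Submodule (ZMod 2) (F2 n)) :
    finrank (ZMod 2) L + finrank (ZMod 2) (dotAnnihilator L) = n := by
  rw [dotAnnihilator, Submodule.comap_equiv_eq_map_symm, LinearEquiv.finrank_map_eq]
  simpa using Subspace.finrank_add_finrank_dualAnnihilator_eq L

theorem dotAnnihilator_injective : Function.Injective (dotAnnihilator (n := n)) := by
  intro L L' h
  exact Subspace.dualAnnihilator_inj.1
    (Submodule.comap_injective_of_surjective (dotProductEquiv (ZMod 2) (Fin n)).surjective h)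

/-- Taking annihilators injects dimension `j` into dimension `n - j`; using this for `k` and for `n
- k` gives both inequalities. -/
theorem card_submodule_finrank_symm {k : ℕ} (hk : k ≤ n) :
    Nat.card {L : Submodule (ZMod 2) (F2 n) // finrank (ZMod 2) L = n - k} =
      Nat.card {L : Submodule (ZMod 2) (F2 n) // finrank (ZMod 2) L = k} := by
  have aux : ∀ j ≤ n, Nat.card {L : Submodule (ZMod 2) (F2 n) // finrank (ZMod 2) L = j} ≤
      Nat.card {L : Submodule (ZMod 2) (F2 n) // finrank (ZMod 2) L = n - j} := by
    intro j hj
    refine Nat.card_le_card_of_injective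
      (fun L => ⟨dotAnnihilator L.1, by
        have := finrank_add_finrank_dotAnnihilator L.1
        rw [L.2] at this
        omega⟩) fun L L' h => Subtype.ext (dotAnnihilator_injective (congrArg Subtype.val h))
  refine le_antisymm ?_ (aux k hk)
  have := aux (n - k) (Nat.sub_le n k)
  rwa [Nat.sub_sub_self hk] at this

open scoped Pointwise in
/-- The number of permutations of `𝔽₂ⁿ` mapping a coset of `W` into a coset of the annihilator
of `L`. -/
theorem card_perm_maps_coset (W L : Submodule (ZMod 2) (F2 n)) (b : F2 n)
    (h : finrank (ZMod 2) W + finrank (ZMod 2) L = n) :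
    Nat.card {π : Equiv.Perm (F2 n) // ∀ l ∈ L, ∀ w ∈ W, dotProduct l (π (b + w) - π b) = 0} *
      (2 ^ n).choose (2 ^ finrank (ZMod 2) W) =
      2 ^ finrank (ZMod 2) L * Nat.card (Equiv.Perm (F2 n)) := by
  classical
  set k := finrank (ZMod 2) W with hk
  have hA : finrank (ZMod 2) (dotAnnihilator L) = k := by
    have := finrank_add_finrank_dotAnnihilator L
    omega
  -- Cosets are treated as points of the set of `2 ^ k`-element subsets, on which the permutations
  -- act transitively; the target `T` below consists of the `2 ^ dim L` cosets of the annihilator.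
  let coset (M : Submodule (ZMod 2) (F2 n)) (hM : finrank (ZMod 2) M = k) (c : F2 n) :
      Set.powersetCard (F2 n) (2 ^ k) :=
    ⟨Finset.univ.map ((Function.Embedding.subtype (· ∈ M)).trans (addLeftEmbedding c)), by
      have := Module.natCard_eq_pow_finrank (K := ZMod 2) (V := M)
      rw [hM, Nat.card_eq_fintype_card (α := M)] at this
      simpa using this⟩
  have mem_coset : ∀ M hM c x, x ∈ (coset M hM c).1 ↔ x - c ∈ M := by
    intro M hM c x
    simp only [coset, Finset.mem_map, Finset.mem_univ, true_and]
    constructor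
    · rintro ⟨m, rfl⟩
      simp
    · intro hx
      exact ⟨⟨_, hx⟩, by simp⟩
  let T : Set (Set.powersetCard (F2 n) (2 ^ k)) := Set.range (coset (dotAnnihilator L) hA)
  have := Set.powersetCard.isPretransitive (α := F2 n) (n := 2 ^ k)
  have hcount := MulAction.card_smul_mem_mul_card (G := Equiv.Perm (F2 n)) (coset W rfl b) T
  have hT : Nat.card T = 2 ^ finrank (ZMod 2) L := by
    have hq : Nat.card (F2 n ⧸ dotAnnihilator L) = 2 ^ finrank (ZMod 2) L := by
      rw [Module.natCard_eq_pow_finrank (K := ZMod 2), Submodule.finrank_quotient, finrank_F2,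
        Nat.card_zmod]
      congr 1
      omega
    rw [← hq]
    refine (Nat.card_congr (Equiv.ofBijective (Quotient.lift (fun c => (⟨_, c, rfl⟩ : T)) ?_)
      ⟨?_, ?_⟩)).symm
    · intro c d hcd
      have hcd' : c - d ∈ dotAnnihilator L := (Submodule.quotientRel_def _).1 hcd
      refine Subtype.ext (Subtype.ext (Finset.ext fun x => ?_))
      rw [mem_coset _ hA, mem_coset _ hA, ← Submodule.add_mem_iff_left _ hcd']
      simp
    · rintro ⟨c⟩ ⟨d⟩ hcd
      have hcd' : coset _ hA c = coset _ hA d := congrArg Subtype.val hcd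
      refine Quotient.sound ((Submodule.quotientRel_def _).2 ?_)
      rw [← mem_coset _ hA, ← hcd', mem_coset _ hA]
      simp
    · rintro ⟨_, c, rfl⟩
      exact ⟨Quotient.mk _ c, rfl⟩
  have hX : Nat.card (Set.powersetCard (F2 n) (2 ^ k)) = (2 ^ n).choose (2 ^ k) := by
    rw [Set.powersetCard.card, card_F2]
  rw [hT, hX] at hcount
  rw [← hcount]
  congr 1
  refine Nat.card_congr (Equiv.subtypeEquivRight fun π => ?_)
  have hsmul : ∀ x, x ∈ (π • coset W rfl b).1 ↔ π.symm x - b ∈ W := by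
    intro x
    rw [← mem_coset W rfl]
    change x ∈ π • (coset W rfl b).1 ↔ _
    rw [Finset.mem_smul_finset]
    constructor
    · rintro ⟨y, hy, rfl⟩
      simpa using hy
    · intro hx
      exact ⟨_, hx, by simp⟩
  constructor
  · intro hπ
    -- The image of the coset of `W` lies in the coset of the annihilator through `π b`; equal
    -- cardinality makes the inclusion an equality.
    refine ⟨π b, Subtype.ext (Finset.eq_of_subset_of_card_le ?_ ?_).symm⟩
    · intro x hx
      rw [hsmul] at hx
      refine (mem_coset _ hA _ _).2 (mem_dotAnnihilator.2 fun l hl => ?_)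
      simpa using hπ l hl _ hx
    · exact le_of_eq ((coset _ hA (π b)).2.trans (π • coset W rfl b).2.symm)
  · rintro ⟨c, hc⟩ l hl w hw
    have hmem : ∀ v ∈ W, π (b + v) - c ∈ dotAnnihilator L := by
      intro v hv
      rw [← mem_coset _ hA, hc, hsmul]
      simpa using hv
    have h1 := hmem w hw
    have h2 := hmem 0 W.zero_mem
    rw [add_zero] at h2
    have h3 := (dotAnnihilator L).sub_mem h1 h2
    rw [sub_sub_sub_cancel_right] at h3
    exact mem_dotAnnihilator.1 h3 l hl

end LocalCount

/-! ### Counting affine subspaces by type, and the exact average -/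

section GlobalCount

open Module

variable {n : ℕ}

theorem finrank_map_snd_add_finrank_comap_inl (D : Submodule (ZMod 2) (F2Pair n)) :
    finrank (ZMod 2) (D.map (LinearMap.snd (ZMod 2) (F2 n) (F2 n))) +
      finrank (ZMod 2) (D.comap (LinearMap.inl (ZMod 2) (F2 n) (F2 n))) = finrank (ZMod 2) D :=
  D.finrank_map_snd_add_finrank_comap_inl

/-- The conditions on `π` and on `φ` given `π` contribute factors `2 ^ (n - k)` and `2 ^ (k + 1)`,
so `k` drops out of the power on the right. -/
theorem card_mmFunction_isAffineOn (U : AffineSubspace (ZMod 2) (F2Pair n))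
    (hU : U ∈ affineSubspacesOfDim (F2Pair n) n) {k : ℕ}
    (hk : finrank (ZMod 2) (U.direction.map (LinearMap.snd (ZMod 2) (F2 n) (F2 n))) = k) :
    Nat.card {q : Equiv.Perm (F2 n) × (F2 n → ZMod 2) // IsAffineOn (mmFunction q.1 q.2) U} *
      ((2 ^ n).choose (2 ^ k) * 2 ^ 2 ^ k) =
      2 ^ (n + 1) * Nat.card (Equiv.Perm (F2 n) × (F2 n → ZMod 2)) := by
  subst hk
  obtain ⟨⟨p, hp⟩, hdim⟩ := hU
  have hsum := finrank_map_snd_add_finrank_comap_inl U.direction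
  rw [hdim] at hsum
  obtain ⟨s, hs⟩ := U.direction.exists_linear_section
  simp_rw [isAffineOn_mmFunction_iff _ _ U hp s hs]
  generalize hW : U.direction.map (LinearMap.snd (ZMod 2) (F2 n) (F2 n)) = W at *
  generalize U.direction.comap (LinearMap.inl (ZMod 2) (F2 n) (F2 n)) = L at *
  clear hW hs
  have h1 := card_perm_maps_coset W L p.2 hsum
  have h2 := fun π : Equiv.Perm (F2 n) =>
    card_affine_restriction W p.2 fun w => dotProduct (p.1 + s w) (π (p.2 + w))
  rw [Nat.card_eq_mul_of_card_fiber (fun q : {q : Equiv.Perm (F2 n) × (F2 n → ZMod 2) //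
      (∀ l ∈ L, ∀ w ∈ W, dotProduct l (q.1 (p.2 + w) - q.1 p.2) = 0) ∧
        ∃ (μ : W →ₗ[ZMod 2] ZMod 2) (c : ZMod 2),
          ∀ w : W, dotProduct (p.1 + s w) (q.1 (p.2 + w)) + q.2 (p.2 + w) = μ w + c} =>
      (⟨q.1.1, q.2.1⟩ : {π : Equiv.Perm (F2 n) //
        ∀ l ∈ L, ∀ w ∈ W, dotProduct l (π (p.2 + w) - π p.2) = 0}))
      -- The number of good `φ` does not depend on `π`, so the identity permutation serves as
      -- reference.
      (c := Nat.card {φ : F2 n → ZMod 2 // ∃ (μ : W →ₗ[ZMod 2] ZMod 2) (c : ZMod 2),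
        ∀ w : W, dotProduct (p.1 + s w) ((1 : Equiv.Perm (F2 n)) (p.2 + w)) + φ (p.2 + w) =
          μ w + c})]
  · rw [Nat.card_prod, show n + 1 = finrank (ZMod 2) L + (finrank (ZMod 2) W + 1) by omega,
      pow_add]
    linear_combination (2 ^ (finrank (ZMod 2) W + 1) * Nat.card (F2 n → ZMod 2)) * h1 +
      Nat.card {π : Equiv.Perm (F2 n) //
        ∀ l ∈ L, ∀ w ∈ W, dotProduct l (π (p.2 + w) - π p.2) = 0} *
      (2 ^ n).choose (2 ^ finrank (ZMod 2) W) * h2 1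
  · rintro ⟨π, hπ⟩
    refine Eq.trans ?_ (Nat.eq_of_mul_eq_mul_right (by positivity) ((h2 π).trans (h2 1).symm))
    exact Nat.card_congr
      { toFun := fun q => ⟨q.1.1.2, by
          have := q.1.2.2
          rwa [show q.1.1.1 = π from congrArg Subtype.val q.2] at this⟩
        invFun := fun φ => ⟨⟨(π, φ.1), hπ, φ.2⟩, rfl⟩
        left_inv := fun q => Subtype.ext (Subtype.ext
          (Prod.ext (congrArg Subtype.val q.2).symm rfl))
        right_inv := fun _ => rfl }

variable (n) in
/-- The number of `k`-dimensional linear subspaces of `𝔽₂ⁿ`. -/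
noncomputable def subspaceCount (k : ℕ) : ℕ :=
  Nat.card {L : Submodule (ZMod 2) (F2 n) // finrank (ZMod 2) L = k}

/-- Choose `W` of dimension `k`, `L` of dimension `n - k` (equally many choices, by duality), and a
slope in `Hom(W, 𝔽₂ⁿ ⧸ L)`, of dimension `k * k`. -/
theorem card_submodule_prod_finrank {k : ℕ} (hk : k ≤ n) :
    Nat.card {D : Submodule (ZMod 2) (F2Pair n) // finrank (ZMod 2) D = n ∧
      finrank (ZMod 2) (D.map (LinearMap.snd (ZMod 2) (F2 n) (F2 n))) = k} =
      subspaceCount n k ^ 2 * 2 ^ (k * k) := by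
  rw [Nat.card_eq_mul_of_card_fiber (fun D : {D : Submodule (ZMod 2) (F2Pair n) //
      finrank (ZMod 2) D = n ∧
        finrank (ZMod 2) (D.map (LinearMap.snd (ZMod 2) (F2 n) (F2 n))) = k} =>
      ((⟨_, D.2.2⟩, ⟨D.1.comap (LinearMap.inl (ZMod 2) (F2 n) (F2 n)), by
        have := finrank_map_snd_add_finrank_comap_inl D.1
        rw [D.2.1, D.2.2] at this
        omega⟩) : {W : Submodule (ZMod 2) (F2 n) // finrank (ZMod 2) W = k} ×
          {L : Submodule (ZMod 2) (F2 n) // finrank (ZMod 2) L = n - k})) (c := 2 ^ (k * k)),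
    Nat.card_prod, card_submodule_finrank_symm hk, subspaceCount, sq]
  rintro ⟨⟨W, hW⟩, ⟨L, hL⟩⟩
  have h := Submodule.card_map_snd_comap_inl W L
  rw [hW, hL, finrank_F2, Nat.sub_sub_self hk, Nat.card_zmod] at h
  rw [← h]
  exact Nat.card_congr
    { toFun := fun D => ⟨D.1.1, congrArg (fun z => z.1.1) D.2, congrArg (fun z => z.2.1) D.2⟩
      invFun := fun D => ⟨⟨D.1, by
        have := finrank_map_snd_add_finrank_comap_inl D.1
        rw [D.2.1, D.2.2, hW, hL] at this
        exact ⟨by omega, by rw [D.2.1, hW]⟩⟩,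
        Prod.ext (Subtype.ext D.2.1) (Subtype.ext D.2.2)⟩
      left_inv := fun _ => rfl
      right_inv := fun _ => rfl }

theorem card_affineSubspace_finrank_map_snd {k : ℕ} (hk : k ≤ n) :
    Nat.card {U : affineSubspacesOfDim (F2Pair n) n //
      finrank (ZMod 2) (U.1.direction.map (LinearMap.snd (ZMod 2) (F2 n) (F2 n))) = k} =
      subspaceCount n k ^ 2 * 2 ^ (k * k) * 2 ^ n := by
  have : Finite (AffineSubspace (ZMod 2) (F2Pair n)) := Finite.of_injective _ SetLike.coe_injective
  rw [← card_submodule_prod_finrank hk]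
  refine Nat.card_eq_mul_of_card_fiber
    (fun U => ⟨U.1.1.direction, U.1.2.2, U.2⟩) ?_
  rintro ⟨D, hD, hDk⟩
  have h := card_affineSubspace_direction D
  rw [Module.natCard_eq_pow_finrank (K := ZMod 2) (V := F2Pair n ⧸ D),
    Submodule.finrank_quotient, hD, finrank_prod,
    finrank_F2, Nat.add_sub_cancel, Nat.card_zmod] at h
  rw [← h]
  exact Nat.card_congr
    { toFun := fun U => ⟨U.1.1.1, U.1.1.2.1, congrArg Subtype.val U.2⟩
      invFun := fun U => ⟨⟨⟨U.1, U.2.1, by rw [U.2.2, hD]⟩, by rw [U.2.2, hDk]⟩,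
        Subtype.ext U.2.2⟩
      left_inv := fun _ => rfl
      right_inv := fun _ => rfl }

theorem mmFunction_injective :
    Function.Injective fun q : Equiv.Perm (F2 n) × (F2 n → ZMod 2) => mmFunction q.1 q.2 := by
  rintro ⟨π, φ⟩ ⟨π', φ'⟩ h
  have hφ : φ = φ' := funext fun y => by
    simpa [mmFunction] using congrFun h (0, y)
  subst hφ
  refine Prod.ext (Equiv.ext fun y => dotProduct_eq _ _ fun x => ?_) rfl
  have := congrFun h (x, y)
  simpa [mmFunction, dotProduct_comm] using this

theorem maioranaMcFarland_eq_range :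
    maioranaMcFarland n =
      Set.range fun q : Equiv.Perm (F2 n) × (F2 n → ZMod 2) => mmFunction q.1 q.2 := by
  ext f
  simp [maioranaMcFarland, eq_comm]

theorem ncard_nearSet (f : F2Pair n → ZMod 2) :
    (nearSet f).ncard = Nat.card {U : affineSubspacesOfDim (F2Pair n) n // IsAffineOn f U.1} := by
  rw [← Nat.card_coe_set_eq]
  refine (Nat.card_congr (Equiv.ofBijective (fun U => ⟨_, U.1.1, U.1.2, U.2, rfl⟩)
    ⟨fun U U' h => ?_, ?_⟩)).symm
  · have h' : Set.indicator (U.1.1 : Set (F2Pair n)) (1 : F2Pair n → ZMod 2) =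
        Set.indicator (U'.1.1 : Set (F2Pair n)) 1 :=
      add_left_cancel (a := f) (congrArg Subtype.val h)
    refine Subtype.ext (Subtype.ext (SetLike.coe_injective ?_))
    exact Set.indicator_one_inj (ZMod 2) h'
  · rintro ⟨_, U, hU, hf, rfl⟩
    exact ⟨⟨⟨U, hU⟩, hf⟩, rfl⟩

/-- The average of `|𝒩(f)|`, sorted by the dimension of the projection of `U` to the second
factor. -/
theorem nearAverage_eq_sum (n : ℕ) :
    nearAverage n = ∑ k ∈ Finset.range (n + 1),
      (subspaceCount n k : ℝ) ^ 2 * 2 ^ (k * k) * 2 ^ n * 2 ^ (n + 1) /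
        (((2 ^ n).choose (2 ^ k) : ℝ) * 2 ^ 2 ^ k) := by
  classical
  have : Finite (AffineSubspace (ZMod 2) (F2Pair n)) := Finite.of_injective _ SetLike.coe_injective
  have := Fintype.ofFinite (affineSubspacesOfDim (F2Pair n) n)
  have hN : (maioranaMcFarland n).ncard = Nat.card (Equiv.Perm (F2 n) × (F2 n → ZMod 2)) := by
    rw [maioranaMcFarland_eq_range, ← Nat.card_coe_set_eq]
    exact (Nat.card_congr (Equiv.ofInjective _ mmFunction_injective)).symm
  have hNpos : 0 < Nat.card (Equiv.Perm (F2 n) × (F2 n → ZMod 2)) := Nat.card_pos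
  have hsum : ∑ f ∈ (Set.toFinite (maioranaMcFarland n)).toFinset, (nearSet f).ncard =
      ∑ U : affineSubspacesOfDim (F2Pair n) n,
        Nat.card {q : Equiv.Perm (F2 n) × (F2 n → ZMod 2) //
          IsAffineOn (mmFunction q.1 q.2) U.1} := by
    have himg : (Set.toFinite (maioranaMcFarland n)).toFinset = Finset.univ.image
        fun q : Equiv.Perm (F2 n) × (F2 n → ZMod 2) => mmFunction q.1 q.2 := by
      ext f
      simp [maioranaMcFarland_eq_range]
    rw [himg, Finset.sum_image mmFunction_injective.injOn]
    simp_rw [ncard_nearSet, Nat.card_eq_fintype_card, Fintype.card_subtype]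
    -- The exchange of summation between functions and affine subspaces.
    exact Finset.sum_card_bipartiteAbove_eq_sum_card_bipartiteBelow
      (fun (q : Equiv.Perm (F2 n) × (F2 n → ZMod 2)) (U : affineSubspacesOfDim (F2Pair n) n) =>
        IsAffineOn (mmFunction q.1 q.2) U.1)
  rw [nearAverage, hN, ← Nat.cast_sum, hsum, Nat.cast_sum, Finset.sum_div]
  have hdim : ∀ U : affineSubspacesOfDim (F2Pair n) n,
      finrank (ZMod 2) (U.1.direction.map (LinearMap.snd (ZMod 2) (F2 n) (F2 n))) ∈
        Finset.range (n + 1) := fun U => by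
    rw [Finset.mem_range, Nat.lt_succ_iff]
    exact (Submodule.finrank_le _).trans finrank_F2.le
  rw [← Finset.sum_fiberwise_of_maps_to fun U _ => hdim U]
  refine Finset.sum_congr rfl fun k hk => ?_
  have hkn : k ≤ n := Nat.lt_succ_iff.1 (Finset.mem_range.1 hk)
  have hchoose : (0 : ℝ) < (2 ^ n).choose (2 ^ k) :=
    Nat.cast_pos.2 (Nat.choose_pos (Nat.pow_le_pow_right (by norm_num) hkn))
  have hcard := card_affineSubspace_finrank_map_snd hkn
  rw [Nat.card_eq_fintype_card, Fintype.card_subtype] at hcard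
  rw [Finset.sum_congr rfl (g := fun _ => (2 : ℝ) ^ (n + 1) /
    (((2 ^ n).choose (2 ^ k) : ℝ) * 2 ^ 2 ^ k)), Finset.sum_const, hcard, nsmul_eq_mul]
  · push_cast
    ring
  · intro U hU
    have h := card_mmFunction_isAffineOn U.1 U.2 (Finset.mem_filter.1 hU).2
    rw [div_eq_div_iff (by positivity) (by positivity)]
    exact_mod_cast h

end GlobalCount

/-! ### Asymptotics of the individual terms -/

section Asymptotic

open Module Topology

theorem subspaceCount_mul_prod {n k : ℕ} (hk : k ≤ n) :
    (subspaceCount n k : ℝ) * ∏ i ∈ Finset.range k, ((2 : ℝ) ^ k - 2 ^ i) =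
      ∏ i ∈ Finset.range k, ((2 : ℝ) ^ n - 2 ^ i) := by
  have h := card_submodule_finrank_mul (K := ZMod 2) (V := F2 n) (k := k) (by rwa [finrank_F2])
  rw [finrank_F2, ZMod.card, Fin.prod_univ_eq_prod_range (fun i => 2 ^ k - 2 ^ i),
    Fin.prod_univ_eq_prod_range (fun i => 2 ^ n - 2 ^ i)] at h
  have cast : ∀ m, k ≤ m → ((∏ i ∈ Finset.range k, (2 ^ m - 2 ^ i) : ℕ) : ℝ) =
      ∏ i ∈ Finset.range k, ((2 : ℝ) ^ m - 2 ^ i) := fun m hm => by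
    rw [Nat.cast_prod]
    refine Finset.prod_congr rfl fun i hi => ?_
    rw [Nat.cast_sub (Nat.pow_le_pow_right (by norm_num)
      ((Finset.mem_range.1 hi).le.trans hm))]
    push_cast
    rfl
  rw [← cast k le_rfl, ← cast n hk, ← h, Nat.cast_mul]
  rfl

theorem choose_mul_factorial_eq_prod {N K : ℕ} (h : K ≤ N) :
    (N.choose K : ℝ) * K.factorial = ∏ i ∈ Finset.range K, ((N : ℝ) - i) := by
  rw [mul_comm, ← Nat.cast_mul, ← Nat.descFactorial_eq_factorial_mul_choose,
    Nat.descFactorial_eq_prod_range, Nat.cast_prod]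
  refine Finset.prod_congr rfl fun i hi => ?_
  rw [Nat.cast_sub ((Finset.mem_range.1 hi).le.trans h)]

/-- This is `(N / K) ^ K ≤ C(N, K)`, obtained factor by factor from `N * (K - i) ≤ (N - i) * K`. -/
theorem pow_le_choose_mul_pow {N K : ℕ} (h : K ≤ N) : N ^ K ≤ N.choose K * K ^ K := by
  refine Nat.le_of_mul_le_mul_right ?_ K.factorial_pos
  calc N ^ K * K.factorial = ∏ i ∈ Finset.range K, N * (K - i) := by
        rw [Finset.prod_mul_distrib, ← Nat.descFactorial_eq_prod_range, Nat.descFactorial_self]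
        simp
    _ ≤ ∏ i ∈ Finset.range K, (N - i) * K := by
        refine Finset.prod_le_prod' fun i _ => ?_
        rw [Nat.mul_sub, Nat.sub_mul]
        exact Nat.sub_le_sub_left (by rw [mul_comm]; exact Nat.mul_le_mul_right i h) _
    _ = N.choose K * K ^ K * K.factorial := by
        rw [Finset.prod_mul_distrib, ← Nat.descFactorial_eq_prod_range,
          Nat.descFactorial_eq_factorial_mul_choose]
        simp
        ring

/-- The expected number of admissible affine subspaces projecting to dimension `k`. -/
noncomputable def expectedCount (n k : ℕ) : ℝ :=
  (subspaceCount n k : ℝ) ^ 2 * 2 ^ (k * k) * 2 ^ n * 2 ^ (n + 1) /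
    (((2 ^ n).choose (2 ^ k) : ℝ) * 2 ^ 2 ^ k)

theorem expectedCount_zero (n : ℕ) : expectedCount n 0 = 2 ^ n := by
  have h := subspaceCount_mul_prod (Nat.zero_le n)
  have hN : (2 : ℝ) ^ n ≠ 0 := by positivity
  simp only [Finset.range_zero, Finset.prod_empty, mul_one] at h
  rw [expectedCount, h]
  simp
  field_simp
  ring

theorem expectedCount_one {n : ℕ} (hn : 1 ≤ n) :
    expectedCount n 1 = 2 * (2 : ℝ) ^ n * (2 ^ n - 1) := by
  have h := subspaceCount_mul_prod hn
  have hN : (2 : ℝ) ≤ 2 ^ n := by simpa using pow_le_pow_right₀ (one_le_two (α := ℝ)) hn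
  have hc := choose_mul_factorial_eq_prod (Nat.pow_le_pow_right (n := 2) (by norm_num) hn)
  norm_num [Finset.prod_range_succ, Nat.factorial] at h hc
  rw [expectedCount, h]
  have h1 : (2 : ℝ) ^ n - 1 ≠ 0 := by linarith
  norm_num
  rw [eq_div_of_mul_eq two_ne_zero hc]
  field_simp
  ring

theorem expectedCount_two {n : ℕ} (hn : 2 ≤ n) :
    expectedCount n 2 =
      4 / 3 * (2 : ℝ) ^ n * (2 ^ n - 1) * (2 ^ n - 2) / (2 ^ n - 3) := by
  have h := subspaceCount_mul_prod hn
  have hN : (4 : ℝ) ≤ 2 ^ n :=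
    le_trans (by norm_num) (pow_le_pow_right₀ (one_le_two (α := ℝ)) hn)
  have hc := choose_mul_factorial_eq_prod (Nat.pow_le_pow_right (n := 2) (by norm_num) hn)
  norm_num [Finset.prod_range_succ, Nat.factorial] at h hc
  rw [expectedCount, eq_div_of_mul_eq (by norm_num) h]
  have h1 : (2 : ℝ) ^ n - 1 ≠ 0 := by linarith
  have h2 : (2 : ℝ) ^ n - 2 ≠ 0 := by linarith
  have h3 : (2 : ℝ) ^ n - 3 ≠ 0 := by linarith
  norm_num
  rw [eq_div_of_mul_eq (by norm_num) hc]
  field_simp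
  ring

/-- The squared Gaussian binomial cancels against the falling factorial of `2 ^ n`: among the
factors `2 ^ n - i` with `1 ≤ i ≤ 7`, those with `i` a power of two survive above, the others below.
-/
theorem expectedCount_three {n : ℕ} (hn : 3 ≤ n) :
    expectedCount n 3 = 40 / 7 * (2 : ℝ) ^ n * (2 ^ n - 1) * (2 ^ n - 2) * (2 ^ n - 4) /
      ((2 ^ n - 3) * (2 ^ n - 5) * (2 ^ n - 6) * (2 ^ n - 7)) := by
  have h := subspaceCount_mul_prod hn
  have hN : (8 : ℝ) ≤ 2 ^ n :=
    le_trans (by norm_num) (pow_le_pow_right₀ (one_le_two (α := ℝ)) hn)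
  have hc := choose_mul_factorial_eq_prod (Nat.pow_le_pow_right (n := 2) (by norm_num) hn)
  norm_num [Finset.prod_range_succ, Nat.factorial] at h hc
  rw [expectedCount, eq_div_of_mul_eq (by norm_num) h]
  have h1 : (2 : ℝ) ^ n - 1 ≠ 0 := by linarith
  have h2 : (2 : ℝ) ^ n - 2 ≠ 0 := by linarith
  have h3 : (2 : ℝ) ^ n - 3 ≠ 0 := by linarith
  have h4 : (2 : ℝ) ^ n - 4 ≠ 0 := by linarith
  have h5 : (2 : ℝ) ^ n - 5 ≠ 0 := by linarith
  have h6 : (2 : ℝ) ^ n - 6 ≠ 0 := by linarith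
  have h7 : (2 : ℝ) ^ n - 7 ≠ 0 := by linarith
  norm_num
  rw [eq_div_of_mul_eq (by norm_num) hc]
  field_simp
  ring

/-- The exponent comparison behind `expectedCount_le`. The first bound is sharp at `k = 4`, and `2 *
k + 6` is the increment of `k * k + 5 * k`, so the second bound drives the induction for the first.
-/
theorem sq_add_five_mul_le_two_pow {k : ℕ} (hk : 4 ≤ k) :
    k * k + 5 * k ≤ 2 ^ k + 20 ∧ 2 * k + 6 ≤ 2 ^ k := by
  induction k, hk using Nat.le_induction with
  | base => norm_num
  | succ k hk ih =>
    obtain ⟨h1, h2⟩ := ih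
    rw [pow_succ]
    constructor <;> nlinarith

/-- In the quotient of products, each numerator factor is at most `2 ^ (k + m)` and each denominator
factor at least `2 ^ (k - 1)`. -/
theorem subspaceCount_le {m k : ℕ} (hk : 1 ≤ k) :
    (subspaceCount (k + m) k : ℝ) ≤ 2 ^ (k * (m + 1)) := by
  have h := subspaceCount_mul_prod (Nat.le_add_right k m)
  have h1 : ∏ i ∈ Finset.range k, ((2 : ℝ) ^ (k + m) - 2 ^ i) ≤ (2 ^ (k + m)) ^ k := by
    calc _ ≤ ∏ _i ∈ Finset.range k, (2 : ℝ) ^ (k + m) := by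
          refine Finset.prod_le_prod (fun i hi => ?_) fun i _ => ?_
          · rw [sub_nonneg]
            exact pow_le_pow_right₀ one_le_two ((Finset.mem_range.1 hi).le.trans (by omega))
          · simp
      _ = _ := by simp
  have h2 : ((2 : ℝ) ^ (k - 1)) ^ k ≤ ∏ i ∈ Finset.range k, ((2 : ℝ) ^ k - 2 ^ i) := by
    calc _ = ∏ _i ∈ Finset.range k, (2 : ℝ) ^ (k - 1) := by simp
      _ ≤ _ := by
          refine Finset.prod_le_prod (fun i _ => by positivity) fun i hi => ?_
          have hi' : (2 : ℝ) ^ i ≤ 2 ^ (k - 1) :=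
            pow_le_pow_right₀ one_le_two (by have := Finset.mem_range.1 hi; omega)
          have hs : (2 : ℝ) ^ k = 2 ^ (k - 1) * 2 := by rw [← pow_succ, Nat.sub_add_cancel hk]
          linarith
  refine le_of_mul_le_mul_right ?_ (show (0 : ℝ) < (2 ^ (k - 1)) ^ k by positivity)
  calc (subspaceCount (k + m) k : ℝ) * (2 ^ (k - 1)) ^ k
      ≤ (2 ^ (k + m)) ^ k := (mul_le_mul_of_nonneg_left h2 (Nat.cast_nonneg _)).trans (h.trans_le h1)
    _ = 2 ^ (k * (m + 1)) * (2 ^ (k - 1)) ^ k := by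
        rw [← pow_mul, ← pow_mul, ← pow_add]
        congr 1
        obtain ⟨j, rfl⟩ := Nat.exists_eq_add_of_le' hk
        rw [Nat.add_sub_cancel]
        ring

/-- With `n = k + m`, the denominator is at least `2 ^ (m * 2 ^ k + 2 ^ k)`, while the numerator has
exponent linear in `m` and quadratic in `k`. The bound is uniform in `k`, so summing over `k` costs
only a factor of order `n`. -/
theorem expectedCount_le {n k : ℕ} (hk : 4 ≤ k) (hkn : k ≤ n) :
    expectedCount n k ≤ 2 ^ 21 / 2 ^ n := by
  obtain ⟨m, rfl⟩ := Nat.exists_eq_add_of_le hkn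
  have hG := subspaceCount_le (m := m) (k := k) (by omega)
  have hle : 2 ^ k ≤ 2 ^ (k + m) := Nat.pow_le_pow_right (by norm_num) hkn
  have hC : (2 : ℝ) ^ (m * 2 ^ k) ≤ ((2 ^ (k + m)).choose (2 ^ k) : ℝ) := by
    have h := pow_le_choose_mul_pow hle
    rw [show (2 ^ (k + m)) ^ 2 ^ k = 2 ^ (m * 2 ^ k) * (2 ^ k) ^ 2 ^ k by
      rw [pow_add, mul_pow, mul_comm, ← pow_mul 2 m]] at h
    exact_mod_cast Nat.le_of_mul_le_mul_right h (by positivity)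
  obtain ⟨e1, e2⟩ := sq_add_five_mul_le_two_pow hk
  rw [expectedCount, div_le_div_iff₀ (mul_pos (lt_of_lt_of_le (by positivity) hC) (by positivity))
    (by positivity)]
  calc (subspaceCount (k + m) k : ℝ) ^ 2 * 2 ^ (k * k) * 2 ^ (k + m) * 2 ^ (k + m + 1) *
        2 ^ (k + m)
      ≤ (2 ^ (k * (m + 1))) ^ 2 * 2 ^ (k * k) * 2 ^ (k + m) * 2 ^ (k + m + 1) * 2 ^ (k + m) := by
        gcongr
    _ = 2 ^ (k * (m + 1) * 2 + k * k + (k + m) + (k + m + 1) + (k + m)) := by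
        rw [← pow_mul, ← pow_add, ← pow_add, ← pow_add, ← pow_add]
    _ ≤ 2 ^ (21 + (m * 2 ^ k + 2 ^ k)) := by
        refine pow_le_pow_right₀ one_le_two ?_
        have := Nat.mul_le_mul_left m e2
        nlinarith
    _ = 2 ^ 21 * (2 ^ (m * 2 ^ k) * 2 ^ 2 ^ k) := by rw [pow_add, pow_add]
    _ ≤ _ := by gcongr

theorem tendsto_two_pow_inv : Tendsto (fun n : ℕ => ((2 : ℝ) ^ n)⁻¹) atTop (𝓝 0) :=
  (tendsto_pow_atTop_atTop_of_one_lt one_lt_two).inv_tendsto_atTop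

theorem tendsto_sum_expectedCount_Ico :
    Tendsto (fun n : ℕ => ∑ k ∈ Finset.Ico 4 (n + 1), expectedCount n k) atTop (𝓝 0) := by
  have hlim : Tendsto (fun n : ℕ => (2 : ℝ) ^ 21 * ((n : ℝ) ^ 1 / 2 ^ n + ((2 : ℝ) ^ n)⁻¹)) atTop
      (𝓝 0) := by
    have := ((tendsto_pow_const_div_const_pow_of_one_lt 1 (one_lt_two (α := ℝ))).add
      tendsto_two_pow_inv).const_mul ((2 : ℝ) ^ 21)
    simpa using this
  refine squeeze_zero (fun n => Finset.sum_nonneg fun k _ => ?_) (fun n => ?_) hlim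
  · rw [expectedCount]; positivity
  · calc _ ≤ ∑ _k ∈ Finset.Ico 4 (n + 1), (2 : ℝ) ^ 21 / 2 ^ n :=
          Finset.sum_le_sum fun k hk => expectedCount_le (Finset.mem_Ico.1 hk).1
            (Nat.lt_succ_iff.1 (Finset.mem_Ico.1 hk).2)
      _ = ((n + 1 - 4 : ℕ) : ℝ) * (2 ^ 21 / 2 ^ n) := by simp
      _ ≤ ((n : ℝ) + 1) * (2 ^ 21 / 2 ^ n) := by
          gcongr
          exact_mod_cast Nat.sub_le (n + 1) 4
      _ = _ := by ring

theorem tendsto_expectedCount_two :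
    Tendsto (fun n => expectedCount n 2 - 4 / 3 * (2 : ℝ) ^ (2 * n)) atTop (𝓝 (8 / 3)) := by
  have h := tendsto_two_pow_inv
  -- With `N = 2 ^ n`, `(N - 1)(N - 2) = N(N - 3) + 2`, so the term is `(4/3)N² + (8/3)N/(N - 3)`,
  -- and `(8/3)N/(N - 3) = 8/3 + 8/(N - 3)`.
  have hlim : Tendsto (fun n : ℕ => 8 / 3 + 8 * ((2 : ℝ) ^ n)⁻¹ / (1 - 3 * ((2 : ℝ) ^ n)⁻¹)) atTop
      (𝓝 (8 / 3 + 8 * 0 / (1 - 3 * 0))) :=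
    tendsto_const_nhds.add ((h.const_mul 8).div (tendsto_const_nhds.sub (h.const_mul 3))
      (by norm_num))
  norm_num at hlim
  refine hlim.congr' ?_
  filter_upwards [eventually_ge_atTop 2] with n hn
  have hN : (4 : ℝ) ≤ 2 ^ n :=
    le_trans (by norm_num) (pow_le_pow_right₀ (one_le_two (α := ℝ)) hn)
  have h3 : (2 : ℝ) ^ n - 3 ≠ 0 := by linarith
  rw [expectedCount_two hn, mul_comm 2 n, pow_mul]
  field_simp
  ring

theorem tendsto_expectedCount_three :
    Tendsto (fun n => expectedCount n 3) atTop (𝓝 (40 / 7)) := by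
  have h : ∀ c : ℝ, Tendsto (fun n : ℕ => 1 - c * ((2 : ℝ) ^ n)⁻¹) atTop (𝓝 1) := fun c => by
    simpa using tendsto_const_nhds.sub (tendsto_two_pow_inv.const_mul c)
  have hlim := ((((h 1).mul (h 2)).mul (h 4)).div ((((h 3).mul (h 5)).mul (h 6)).mul (h 7))
    (by norm_num)).const_mul (40 / 7)
  norm_num at hlim
  refine hlim.congr' ?_
  filter_upwards [eventually_ge_atTop 3] with n hn
  have hN : (8 : ℝ) ≤ 2 ^ n :=
    le_trans (by norm_num) (pow_le_pow_right₀ (one_le_two (α := ℝ)) hn)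
  have h3 : (2 : ℝ) ^ n - 3 ≠ 0 := by linarith
  have h5 : (2 : ℝ) ^ n - 5 ≠ 0 := by linarith
  have h6 : (2 : ℝ) ^ n - 6 ≠ 0 := by linarith
  have h7 : (2 : ℝ) ^ n - 7 ≠ 0 := by linarith
  rw [expectedCount_three hn]
  field_simp

theorem tendsto_nearAverage_sub :
    Tendsto (fun n : ℕ => nearAverage n - (10 / 3 * (2 : ℝ) ^ (2 * n) - (2 : ℝ) ^ n + 176 / 21))
      atTop (𝓝 0) := by
  have hlim := ((tendsto_expectedCount_two.add tendsto_expectedCount_three).add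
    tendsto_sum_expectedCount_Ico).sub_const (176 / 21)
  -- The constant term arises here: `8/3 + 40/7 = 176/21`.
  norm_num at hlim
  refine hlim.congr' ?_
  filter_upwards [eventually_ge_atTop 3] with n hn
  have hsum : nearAverage n = ∑ k ∈ Finset.range (n + 1), expectedCount n k :=
    nearAverage_eq_sum n
  rw [hsum, ← Finset.sum_range_add_sum_Ico _ (show 4 ≤ n + 1 by omega)]
  simp only [Finset.sum_range_succ, Finset.sum_range_zero]
  rw [expectedCount_zero, expectedCount_one (by omega), mul_comm 2 n, pow_mul]
  ring

end Asymptotic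

/-- The three main terms are identical as polynomials in `2 ^ n`, so one limit settles all of them.
-/
theorem mainTheorem10 :
    ((fun n : ℕ => nearAverage n -
        (10 / 3 * (2 : ℝ) ^ (2 * n) - (2 : ℝ) ^ n + 176 / 21))
      =o[atTop] (fun _ : ℕ => (1 : ℝ))) ∧
    ((fun n : ℕ => nearAverage n -
        (((2 : ℝ) ^ (2 * n + 1) - (2 : ℝ) ^ n) + 4 / 3 * (2 : ℝ) ^ (2 * n) + 176 / 21))
      =o[atTop] (fun _ : ℕ => (1 : ℝ))) ∧
    ((fun n : ℕ => nearAverage n -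
        (5 / 3 * ((2 : ℝ) ^ (2 * n + 1) - (2 : ℝ) ^ n) + 2 / 3 * (2 : ℝ) ^ n + 176 / 21))
      =o[atTop] (fun _ : ℕ => (1 : ℝ))) := by
  simp only [isLittleO_one_iff]
  refine ⟨tendsto_nearAverage_sub, tendsto_nearAverage_sub.congr fun n => ?_,
    tendsto_nearAverage_sub.congr fun n => ?_⟩ <;>
  · rw [pow_succ]
    ring
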